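/- Let $m\ge 1$ and let $D\subseteq\mathbb R$ be an interval with end points $t_0<T$ (possibly infinite). Let $\mathcal L[v]=c_m v^{(m)}+\dots+c_1v'+c_0v$ have continuous coefficients on $D$ with $c_m$ nowhere zero, and let $y$ be a zero-mean Gaussian process on $D$ with $C^{m-1}$ paths which solves the forward stochastic differential equation $\mathcal L[y]=W$, where $W$ is Gaussian white noise with spectrum $1$ whose restriction to times after $s$ is independent of $(y(r))_{r\le s}$ for each $s$. Assume Condition 1: $\mathcal L h=0$ has $m$ linearly independent solutions on $D$, each of them bounded on $D$. Let $K(t,t')=\mathbb E[y(t)y(t')]$. We say that a kernel $K$ has a $(2m)\times(2m+1)$ kernel packet (KP) system with respect to an operator $\mathcal L$ of order $m$ if $K(t,\cdot)\in C^{m-1}(D)$ for all $t\in D$ and there are $m$ linearly independent solutions $P_1,\dots,P_m$ of $\mathcal L P=0$ on $D$ such that, for all $t_1<\dots<t_{2m+1}$ in $(t_0,T)$, the following holds. Put $R_{1,i}(t,s)=\partial_s^{i-1}K(t,s)$ and $$h=[P_1,\dots,P_m,R_{1,1}(\cdot,t_{2m+1}),\dots,R_{1,m}(\cdot,t_{2m+1})]^T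 .$$ Then 1. $\sum_{j=1}^{2m+1}a_jh(t_j)=0$ if and only if the KP equations $\sum_{j}a_jR_{1,i}(t_j,t_1)=0$ and $\sum_{j}a_jR_{1,i}(t_j,t_{2m+1})=0$ hold for $i=1,\dots,m$; 2. the space of solutions $a\in\mathbb R^{2m+1}$ of $\sum_{j}a_jh(t_j)=0$ is one-dimensional; 3. for each non-zero solution $a$ the function $\sum_{j}a_jK(\cdot,t_j)$ is a kernel packet: it vanishes on $D\setminus(t_1,t_{2m+1})$ and is not identically zero. Suppose that $K$ has a $(2m)\times(2m+1)$ KP system with respect to $\mathcal L$. Let $f$ be a real function without zeros on $D$ such that $1/f$ is $m$ times continuously differentiable on $D$. Then the kernel $f(t)f(t')K(t,t')$ also has a $(2m)\times(2m+1)$ KP system. More precisely, there is an operator $\tilde{\mathcal L}$ of order $m$ with continuous coefficients on $D$ and nowhere vanishing leading coefficient, $\tilde{\mathcal L}[v]=\mathcal L[v/f]$ for all $v\in C^m(D)$, such that $\tilde y=fy$ is a zero-mean Gaussian process with $C^{m-1}$ paths which solves the forward equation $\tilde{\mathcal L}[\tilde y]=W$ with the same noise (again independent, after each time $s$, of $\tilde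 y$ up to time $s$), has covariance $f(t)f(t')K(t,t')$, and this kernel has a $(2m)\times(2m+1)$ KP system with respect to $\tilde{\mathcal L}$. -/

import Mathlib

open MeasureTheory ProbabilityTheory Set

namespace KernelPacket

/-- The linear differential operator `L[v] = c_m v^(m) + ... + c_1 v' + c_0 v` on the interval `D`
(derivatives at an end point that belongs to `D` are one-sided). -/
noncomputable def diffOp {m : ℕ} (D : Set ℝ) (c : Fin (m + 1) → ℝ → ℝ) (v : ℝ → ℝ) (t : ℝ) : ℝ :=
  ∑ k : Fin (m + 1), c k t * iteratedDerivWithin k v D t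

/-- The coefficients are continuous on `D` and the leading one has no zero there. -/
structure IsRegularOperator {m : ℕ} (D : Set ℝ) (c : Fin (m + 1) → ℝ → ℝ) : Prop where
  continuousOn : ∀ k, ContinuousOn (c k) D
  leading_ne_zero : ∀ t ∈ D, c (Fin.last m) t ≠ 0

/-- `h_1, ..., h_m` are `m` linearly independent solutions of `L[h] = 0` on `D`. -/
structure IsFundamentalSystem {m : ℕ} (D : Set ℝ) (c : Fin (m + 1) → ℝ → ℝ)
    (h : Fin m → ℝ → ℝ) : Prop where
  contDiffOn : ∀ i, ContDiffOn ℝ m (h i) D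
  diffOp_eq_zero : ∀ i, ∀ t ∈ D, diffOp D c (h i) t = 0
  linearIndependent : LinearIndependent ℝ (fun i => D.domRestrict (h i))

/-- There are `m` linearly independent fundamental solutions of `L`, each of them bounded. -/
def BoundedFundamentalSolutions {m : ℕ} (D : Set ℝ) (c : Fin (m + 1) → ℝ → ℝ) : Prop :=
  ∃ h : Fin m → ℝ → ℝ, IsFundamentalSystem D c h ∧ ∀ i, ∃ C : ℝ, ∀ t ∈ D, |h i t| ≤ C

/-- Test functions of class `C^n` with compact support in the interior of `D`. -/
structure IsTestFunction (D : Set ℝ) (n : ℕ) (φ : ℝ → ℝ) : Prop where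
  contDiff : ContDiff ℝ n φ
  hasCompactSupport : HasCompactSupport φ
  tsupport_subset : tsupport φ ⊆ interior D

variable {Ω : Type*} [MeasurableSpace Ω]

/-- Gaussian white noise with spectrum `1` on `D`, as a generalized random process: `W φ` stands
for `∫ φ(t) W(t) dt`. It is linear in `φ` and `W φ ~ N(0, ∫ φ²)`; hence it is jointly Gaussian
with `E[W φ * W ψ] = ∫ φ ψ`, that is `E[W(t) W(t')] = δ(t - t')`. -/
structure IsWhiteNoise (D : Set ℝ) (μ : Measure Ω) (W : (ℝ → ℝ) → Ω → ℝ) : Prop where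
  linear : ∀ φ ψ : ℝ → ℝ, IsTestFunction D 0 φ → IsTestFunction D 0 ψ → ∀ a b : ℝ,
    W (fun t => a * φ t + b * ψ t) =ᵐ[μ] fun ω => a * W φ ω + b * W ψ ω
  hasLaw : ∀ φ : ℝ → ℝ, IsTestFunction D 0 φ →
    HasLaw (W φ) (gaussianReal 0 (∫ t, φ t ^ 2).toNNReal) μ

/-- `y` is a zero-mean Gaussian process on `D` that solves the forward stochastic differential
equation `c_m y^(m) + ... + c_1 y' + c_0 y = W`. The paths are of class `C^(m-1)`, and the
equation, divided by `c_m`, holds in the weak sense: its highest derivative is moved to the test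
function, and `W / c_m` acts on `φ` as `W (φ / c_m)`. The solution is a forward one: for each `s`
the noise on `(s, ∞) ∩ D` is independent of the process up to time `s`. -/
structure IsSDESolution {m : ℕ} (D : Set ℝ) (c : Fin (m + 1) → ℝ → ℝ) (μ : Measure Ω)
    (W : (ℝ → ℝ) → Ω → ℝ) (y : ℝ → Ω → ℝ) : Prop where
  gaussian : IsGaussianProcess (fun t : D => y t) μ
  mean_zero : ∀ t ∈ D, ∫ ω, y t ω ∂μ = 0
  paths : ∀ᵐ ω ∂μ, ContDiffOn ℝ ((m - 1 : ℕ) : ℕ∞) (fun t => y t ω) D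
  equation : ∀ φ : ℝ → ℝ, IsTestFunction D 1 φ → ∀ᵐ ω ∂μ,
    -(∫ t in D, iteratedDerivWithin (m - 1) (fun s => y s ω) D t * deriv φ t) +
      ∑ k : Fin m, ∫ t in D, c k.castSucc t / c (Fin.last m) t *
        iteratedDerivWithin k (fun s => y s ω) D t * φ t =
      W (fun t => φ t / c (Fin.last m) t) ω
  causal : ∀ s ∈ D, IndepFun
    (fun ω (r : {r : ℝ // r ∈ D ∧ r ≤ s}) => y r ω)
    (fun ω (φ : {φ : ℝ → ℝ // IsTestFunction D 0 φ ∧ tsupport φ ⊆ Ioi s}) => W φ ω) μ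

/-- `R_{1,i+1}(t, s) = ∂^i K(t, s) / ∂s^i`, which is `E[y(t) y^(i)(s)]` for the kernel `K` of
`y`. -/
noncomputable def kernelDeriv (D : Set ℝ) (K : ℝ → ℝ → ℝ) (i : ℕ) (t s : ℝ) : ℝ :=
  iteratedDerivWithin i (fun r => K t r) D s

/-- The `2m × (2m+1)` matrix `[h(t_1), ..., h(t_{2m+1})]`, where `h` consists of the fundamental
solutions `P_1, ..., P_m` and of the functions `R_{1,i}(·, t_{2m+1})`, `i = 1, ..., m`. -/
noncomputable def kpMatrix {m : ℕ} (D : Set ℝ) (K : ℝ → ℝ → ℝ) (P : Fin m → ℝ → ℝ)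
    (τ : Fin (2 * m + 1) → ℝ) : Matrix (Fin m ⊕ Fin m) (Fin (2 * m + 1)) ℝ :=
  Matrix.fromRows (Matrix.of fun i j => P i (τ j))
    (Matrix.of fun i j => kernelDeriv D K i (τ j) (τ (Fin.last (2 * m))))

/-- The right- and left-sided kernel packet equations at `t_1 < ... < t_{2m+1}`:
`∑_j a_j E[y^(i)(t) y(t_j)] = 0` for `t = t_1`, `t = t_{2m+1}` and `i = 0, ..., m - 1`. -/
def KPEquations (m : ℕ) (D : Set ℝ) (K : ℝ → ℝ → ℝ) (τ : Fin (2 * m + 1) → ℝ)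
    (a : Fin (2 * m + 1) → ℝ) : Prop :=
  (∀ i : Fin m, ∑ j, a j * kernelDeriv D K i (τ j) (τ 0) = 0) ∧
  (∀ i : Fin m, ∑ j, a j * kernelDeriv D K i (τ j) (τ (Fin.last (2 * m))) = 0)

/-- `φ = ∑_j a_j K(·, t_j)` is a (non-vanishing) kernel packet: it is zero on `D` outside
`(t_1, t_{2m+1})`. -/
structure IsKernelPacket (m : ℕ) (D : Set ℝ) (K : ℝ → ℝ → ℝ) (τ : Fin (2 * m + 1) → ℝ)
    (a : Fin (2 * m + 1) → ℝ) : Prop where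
  support : ∀ t ∈ D, t ∉ Ioo (τ 0) (τ (Fin.last (2 * m))) → ∑ j, a j * K t (τ j) = 0
  nonvanishing : ∃ t ∈ D, ∑ j, a j * K t (τ j) ≠ 0

/-- The kernel `K`, with the operator `L` of order `m` given by `c`, has a `2m × (2m+1)` kernel
packet system: for all points `t_1 < ... < t_{2m+1}` in the interior of `D`, the linear system
`∑_j a_j h(t_j) = 0` of `2m` equations in `2m+1` unknowns is equivalent to the kernel packet
equations, has a one-dimensional space of solutions, and each non-zero solution gives a kernel
packet. -/
def HasKPSystem {m : ℕ} (D : Set ℝ) (c : Fin (m + 1) → ℝ → ℝ) (K : ℝ → ℝ → ℝ) : Prop :=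
  (∀ t ∈ D, ContDiffOn ℝ ((m - 1 : ℕ) : ℕ∞) (fun s => K t s) D) ∧
  ∃ P : Fin m → ℝ → ℝ, IsFundamentalSystem D c P ∧
    ∀ τ : Fin (2 * m + 1) → ℝ, StrictMono τ → (∀ j, τ j ∈ interior D) →
      (∀ a, (kpMatrix D K P τ).mulVec a = 0 ↔ KPEquations m D K τ a) ∧
      Module.finrank ℝ (LinearMap.ker (kpMatrix D K P τ).mulVecLin) = 1 ∧
      (∀ a, a ≠ 0 → (kpMatrix D K P τ).mulVec a = 0 → IsKernelPacket m D K τ a)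

end KernelPacket

/-! Put `g = 1/f` and `L~[v] = L[v g]`. Leibniz' rule gives the coefficients of `L~` (`mulCoeff`),
the leading one being `c_m g`; the solutions of `L~ P = 0` are `f P_i`. The equation for `f y`,
tested with `φ`, is the equation for `y` tested with `ψ = f φ`, and the noise terms agree because `φ
/ (c_m g) = f φ / c_m`. Since `y` is only `C^(m-1)`, Leibniz' rule of order `m` is not available for
it; `setIntegral_iteratedDerivWithin_mul_deriv` is its weak form, and `weak_lhs_mulCoeff` compares
the two equations. For the kernel packets, `b_j = a_j f(t_j)` gives `∑ a_j f(t) f(t_j) K(t, t_j) =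
f(t) ∑ b_j K(t, t_j)`. By Leibniz' rule with `f` and with `1/f`, the derivatives of order below `m`
of `G` and of `f G` vanish at a point simultaneously (`forall_sum_kernelDeriv_mul_eq_zero_iff`).
Hence the linear systems correspond under the invertible map `a ↦ b`. -/

namespace KernelPacket

/-! ### Leibniz' rule for derivatives within `D` -/

theorem iteratedDerivWithin_mul_eq_sum {D : Set ℝ} (hD : UniqueDiffOn ℝ D) {n : ℕ} {u g : ℝ → ℝ}
    (hu : ContDiffOn ℝ n u D) (hg : ContDiffOn ℝ n g D) {t : ℝ} (ht : t ∈ D) :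
    iteratedDerivWithin n (fun s => u s * g s) D t =
      ∑ i ∈ Finset.range (n + 1),
        (n.choose i : ℝ) * (iteratedDerivWithin i u D t * iteratedDerivWithin (n - i) g D t) := by
  have := iteratedDerivWithin_mul ht hD (hu t ht) (hg t ht)
  simp only [mul_assoc] at this
  exact this

theorem iteratedDerivWithin_mul_eq_zero {D : Set ℝ} (hD : UniqueDiffOn ℝ D) {m n : ℕ} (hn : n < m)
    {u g : ℝ → ℝ} (hu : ContDiffOn ℝ n u D) (hg : ContDiffOn ℝ n g D) {t : ℝ} (ht : t ∈ D)
    (h : ∀ i < m, iteratedDerivWithin i u D t = 0) :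
    iteratedDerivWithin n (fun s => u s * g s) D t = 0 := by
  rw [iteratedDerivWithin_mul_eq_sum hD hu hg ht]
  refine Finset.sum_eq_zero fun i hi => ?_
  rw [h i (by have := Finset.mem_range.1 hi; omega)]
  ring

theorem iteratedDerivWithin_sum_mul {D : Set ℝ} (hD : UniqueDiffOn ℝ D) {ι : Type*} [Fintype ι]
    {n : ℕ} {a : ι → ℝ} {F : ι → ℝ → ℝ} (hF : ∀ j, ContDiffOn ℝ n (F j) D) {t : ℝ} (ht : t ∈ D) :
    iteratedDerivWithin n (fun s => ∑ j, a j * F j s) D t =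
      ∑ j, a j * iteratedDerivWithin n (F j) D t := by
  rw [iteratedDerivWithin_fun_sum ht hD
    (fun j _ => (contDiffOn_const.mul (hF j)) t ht)]
  refine Finset.sum_congr rfl fun j _ => ?_
  rw [iteratedDerivWithin_const_mul_field]

theorem hasDerivAt_iteratedDerivWithin {D : Set ℝ} (hD : UniqueDiffOn ℝ D) {n i : ℕ} (hi : i < n)
    {u : ℝ → ℝ} (hu : ContDiffOn ℝ n u D) {t : ℝ} (ht : t ∈ interior D) :
    HasDerivAt (iteratedDerivWithin i u D) (iteratedDerivWithin (i + 1) u D t) t := by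
  have hdiff := hu.differentiableOn_iteratedDerivWithin (m := i) (by exact_mod_cast hi) hD
  rw [iteratedDerivWithin_succ]
  exact (hdiff t (interior_subset ht)).hasDerivWithinAt.hasDerivAt (mem_interior_iff_mem_nhds.1 ht)

/-- Pascal's rule for a differentiated Leibniz sum lacking its term `i = n`. That term would
contribute `a (n + 1) * b 0 + a n * b 1`; leaving it out avoids `a (n + 1)`, the derivative that
need not exist. -/
theorem sum_choose_succ_sub {n : ℕ} (a b : ℕ → ℝ) :
    ∑ i ∈ Finset.range n, (n.choose i : ℝ) * (a (i + 1) * b (n - i) + a i * b (n - i + 1)) =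
      ∑ i ∈ Finset.range (n + 1), ((n + 1).choose i : ℝ) * (a i * b (n + 1 - i)) - b 1 * a n := by
  have h := Finset.sum_choose_succ_mul (fun i j => a i * b j) n
  rw [Finset.sum_range_succ, Finset.sum_range_succ (n := n)
    (f := fun i => (n.choose i : ℝ) * (a i * b (n + 1 - i))), Finset.sum_range_succ (n := n)
    (f := fun i => (n.choose i : ℝ) * (a (i + 1) * b (n - i)))] at h
  simp only [Nat.choose_self, Nat.sub_self, Nat.add_sub_cancel_left, Nat.cast_one, one_mul] at h
  have h2 : ∑ i ∈ Finset.range n, (n.choose i : ℝ) * (a i * b (n - i + 1)) =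
      ∑ i ∈ Finset.range n, (n.choose i : ℝ) * (a i * b (n + 1 - i)) :=
    Finset.sum_congr rfl fun i hi => by
      rw [Nat.sub_add_comm (Finset.mem_range.1 hi).le]
  simp only [mul_add, Finset.sum_add_distrib, h2]
  linarith

/-! ### Test functions -/

section TestFunctions

variable {D : Set ℝ}

theorem IsTestFunction.of_le {n k : ℕ} (h : k ≤ n) {φ : ℝ → ℝ} (hφ : IsTestFunction D n φ) :
    IsTestFunction D k φ :=
  ⟨hφ.contDiff.of_le (by exact_mod_cast h), hφ.hasCompactSupport, hφ.tsupport_subset⟩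

/-- The behaviour of `f` off `D` is irrelevant: `D` is a neighbourhood of each point of `tsupport
φ`, and elsewhere the product is locally zero. -/
theorem IsTestFunction.mul_left {n : ℕ} {φ f : ℝ → ℝ} (hφ : IsTestFunction D n φ)
    (hf : ContDiffOn ℝ n f D) : IsTestFunction D n (fun t => f t * φ t) where
  contDiff := by
    refine contDiff_iff_contDiffAt.2 fun t => ?_
    by_cases ht : t ∈ tsupport φ
    · exact (hf.contDiffAt (mem_interior_iff_mem_nhds.1 (hφ.tsupport_subset ht))).mul
        hφ.contDiff.contDiffAt
    · refine (contDiffAt_const (c := (0 : ℝ))).congr_of_eventuallyEq ?_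
      filter_upwards [notMem_tsupport_iff_eventuallyEq.1 ht] with s hs
      simp [hs]
  hasCompactSupport := hφ.hasCompactSupport.mul_left
  tsupport_subset := (tsupport_mul_subset_right (f := f) (g := φ)).trans hφ.tsupport_subset

theorem IsTestFunction.deriv {φ : ℝ → ℝ} (hφ : IsTestFunction D 1 φ) :
    IsTestFunction D 0 (deriv φ) where
  contDiff := by
    have := hφ.contDiff.continuous_deriv (by norm_num)
    exact_mod_cast contDiff_zero.2 this
  hasCompactSupport := hφ.hasCompactSupport.deriv
  tsupport_subset := (tsupport_deriv_subset).trans hφ.tsupport_subset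

theorem IsTestFunction.integrable_mul {φ F : ℝ → ℝ} (hφ : IsTestFunction D 0 φ)
    (hF : ContinuousOn F D) : Integrable (fun t => F t * φ t) := by
  have h := hφ.mul_left (f := F) (by exact_mod_cast contDiffOn_zero.2 hF)
  exact h.contDiff.continuous.integrable_of_hasCompactSupport h.hasCompactSupport

theorem IsTestFunction.eq_zero {n : ℕ} {φ : ℝ → ℝ} (hφ : IsTestFunction D n φ) {t : ℝ}
    (ht : t ∉ D) : φ t = 0 :=
  image_eq_zero_of_notMem_tsupport fun h => ht (interior_subset (hφ.tsupport_subset h))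

theorem IsTestFunction.setIntegral_mul {n : ℕ} {φ F : ℝ → ℝ} (hφ : IsTestFunction D n φ) :
    ∫ t in D, F t * φ t = ∫ t, F t * φ t :=
  setIntegral_eq_integral_of_forall_compl_eq_zero fun t ht => by simp [hφ.eq_zero ht]

end TestFunctions

/-! ### Weak form of Leibniz' rule -/

/-- Moving one derivative of `(u g)^(n)` to the test function `ψ`, where `u` is only of class
`C^n`: the missing derivative `u^(n+1)` is replaced by the weak derivative of `u^(n)`. -/
theorem setIntegral_iteratedDerivWithin_mul_deriv {D : Set ℝ} (hD : UniqueDiffOn ℝ D) {n : ℕ}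
    {u g ψ : ℝ → ℝ} (hu : ContDiffOn ℝ n u D) (hg : ContDiffOn ℝ (n + 1 : ℕ) g D)
    (hψ : IsTestFunction D 1 ψ) :
    ∫ t in D, iteratedDerivWithin n (fun s => u s * g s) D t * deriv ψ t =
      (∫ t in D, iteratedDerivWithin n u D t * deriv (fun s => g s * ψ s) t) -
      ∫ t in D, (∑ i ∈ Finset.range (n + 1), ((n + 1).choose i : ℝ) *
        (iteratedDerivWithin i u D t * iteratedDerivWithin (n + 1 - i) g D t)) * ψ t := by
  have hφ : IsTestFunction D 1 (fun s => g s * ψ s) :=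
    hψ.mul_left (hg.of_le (by exact_mod_cast Nat.le_add_left 1 n))
  have hψ0 := hψ.of_le (Nat.zero_le 1)
  have cu : ∀ i ≤ n, ContinuousOn (iteratedDerivWithin i u D) D := fun i hi =>
    hu.continuousOn_iteratedDerivWithin (by exact_mod_cast hi) hD
  have cg : ∀ i ≤ n + 1, ContinuousOn (iteratedDerivWithin i g D) D := fun i hi =>
    hg.continuousOn_iteratedDerivWithin (by exact_mod_cast hi) hD
  have hgn : ContDiffOn ℝ n g D := hg.of_le (by exact_mod_cast Nat.le_succ n)
  -- All integrands vanish off `D`, so the integrals extend to the line and integration by parts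
  -- leaves no boundary terms.
  rw [hψ.deriv.setIntegral_mul, hφ.deriv.setIntegral_mul, hψ.setIntegral_mul]
  -- `E` is `(u g)^(n)` without `u^(n) g`, hence still differentiable; `E'` is its derivative. `B`
  -- is the Leibniz sum of order `n + 1` without `u^(n+1) g`.
  set E : ℝ → ℝ := fun t => ∑ i ∈ Finset.range n, (n.choose i : ℝ) *
    (iteratedDerivWithin i u D t * iteratedDerivWithin (n - i) g D t) with hE
  set E' : ℝ → ℝ := fun t => ∑ i ∈ Finset.range n, (n.choose i : ℝ) *
    (iteratedDerivWithin (i + 1) u D t * iteratedDerivWithin (n - i) g D t +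
      iteratedDerivWithin i u D t * iteratedDerivWithin (n - i + 1) g D t) with hE'
  set B : ℝ → ℝ := fun t => ∑ i ∈ Finset.range (n + 1), ((n + 1).choose i : ℝ) *
    (iteratedDerivWithin i u D t * iteratedDerivWithin (n + 1 - i) g D t) with hB
  have cE : ContinuousOn E D := continuousOn_finsetSum _ fun i hi => by
    have hi := Finset.mem_range.1 hi
    exact continuousOn_const.mul ((cu i hi.le).mul (cg _ (by omega)))
  have cE' : ContinuousOn E' D := continuousOn_finsetSum _ fun i hi => by
    have hi := Finset.mem_range.1 hi
    exact continuousOn_const.mul (((cu (i + 1) hi).mul (cg _ (by omega))).add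
      ((cu i hi.le).mul (cg _ (by omega))))
  have cB : ContinuousOn B D := continuousOn_finsetSum _ fun i hi => by
    have hi := Finset.mem_range.1 hi
    exact continuousOn_const.mul ((cu i (by omega)).mul (cg _ (by omega)))
  have parts : ∫ t, E t * deriv ψ t = -∫ t, E' t * ψ t := by
    refine integral_mul_deriv_eq_deriv_mul_of_integrable (fun t ht => ?_)
      (fun t _ => (hψ.contDiff.differentiable (by norm_num) t).hasDerivAt)
      (hψ.deriv.integrable_mul cE) (hψ0.integrable_mul cE') (hψ0.integrable_mul cE)
    have ht := hψ.tsupport_subset ht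
    refine HasDerivAt.fun_sum fun i hi => ?_
    have hi := Finset.mem_range.1 hi
    exact ((hasDerivAt_iteratedDerivWithin hD hi hu ht).mul
      (hasDerivAt_iteratedDerivWithin hD (by omega) hg ht)).const_mul _
  -- The last bracket is `(E ψ)'` on the support of `ψ`, so its integral is zero by `parts`.
  have key : ∀ t, iteratedDerivWithin n (fun s => u s * g s) D t * deriv ψ t =
      iteratedDerivWithin n u D t * deriv (fun s => g s * ψ s) t - B t * ψ t +
        (E t * deriv ψ t + E' t * ψ t) := by
    intro t
    by_cases ht : t ∈ tsupport ψ
    · have hti := hψ.tsupport_subset ht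
      have h1 : HasDerivAt g (iteratedDerivWithin 1 g D t) t := by
        simpa using hasDerivAt_iteratedDerivWithin hD (Nat.succ_pos n) hg hti
      have h2 : deriv (fun s => g s * ψ s) t =
          iteratedDerivWithin 1 g D t * ψ t + g t * deriv ψ t :=
        (h1.mul (hψ.contDiff.differentiable (by norm_num) t).hasDerivAt).deriv
      have h3 : E' t = B t - iteratedDerivWithin 1 g D t * iteratedDerivWithin n u D t :=
        sum_choose_succ_sub (fun i => iteratedDerivWithin i u D t)
          (fun i => iteratedDerivWithin i g D t)
      have h4 : iteratedDerivWithin n (fun s => u s * g s) D t =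
          E t + iteratedDerivWithin n u D t * g t := by
        rw [iteratedDerivWithin_mul_eq_sum hD hu hgn (interior_subset hti),
          Finset.sum_range_succ]
        simp [hE]
      rw [h2, h3, h4]
      ring
    · have h0 : deriv ψ t = 0 :=
        image_eq_zero_of_notMem_tsupport fun h => ht (tsupport_deriv_subset h)
      have h1 : deriv (fun s => g s * ψ s) t = 0 :=
        image_eq_zero_of_notMem_tsupport fun h => ht
          (tsupport_mul_subset_right (f := g) (g := ψ) (tsupport_deriv_subset h))
      simp [h0, h1, image_eq_zero_of_notMem_tsupport ht]
  have i1 := hψ.deriv.integrable_mul cE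
  have i2 := hψ0.integrable_mul cE'
  have i3 := hψ0.integrable_mul cB
  have i4 := hφ.deriv.integrable_mul (cu n le_rfl)
  have i5 : Integrable (fun t => iteratedDerivWithin n u D t * deriv (fun s => g s * ψ s) t -
    B t * ψ t) := i4.sub i3
  have i6 : Integrable (fun t => E t * deriv ψ t + E' t * ψ t) := i1.add i2
  rw [integral_congr_ae (Filter.Eventually.of_forall key), integral_add i5 i6,
    integral_sub i4 i3, integral_add i1 i2, parts]
  ring

/-! ### The operator `v ↦ L[v g]` -/

/-- The coefficients of the operator `v ↦ L[v g]`. -/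
noncomputable def mulCoeff {m : ℕ} (D : Set ℝ) (c : Fin (m + 1) → ℝ → ℝ) (g : ℝ → ℝ)
    (k : Fin (m + 1)) (t : ℝ) : ℝ :=
  ∑ l : Fin (m + 1), c l t * (((l : ℕ).choose k : ℝ) * iteratedDerivWithin (l - k) g D t)

theorem mulCoeff_last {m : ℕ} (D : Set ℝ) (c : Fin (m + 1) → ℝ → ℝ) (g : ℝ → ℝ) (t : ℝ) :
    mulCoeff D c g (Fin.last m) t = c (Fin.last m) t * g t := by
  rw [mulCoeff, Fin.sum_univ_castSucc]
  simp [Nat.choose_eq_zero_of_lt]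

theorem isRegularOperator_mulCoeff {m : ℕ} {D : Set ℝ} (hD : UniqueDiffOn ℝ D)
    {c : Fin (m + 1) → ℝ → ℝ} (hc : IsRegularOperator D c) {g : ℝ → ℝ}
    (hg : ContDiffOn ℝ m g D) (hg0 : ∀ t ∈ D, g t ≠ 0) :
    IsRegularOperator D (mulCoeff D c g) where
  continuousOn k := continuousOn_finsetSum _ fun l _ =>
    (hc.continuousOn l).mul (continuousOn_const.mul
      (hg.continuousOn_iteratedDerivWithin (by norm_cast; omega) hD))
  leading_ne_zero t ht := by
    rw [mulCoeff_last]
    exact mul_ne_zero (hc.leading_ne_zero t ht) (hg0 t ht)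

/-- Binomial coefficients beyond `l` vanish, so the range of `k` need not depend on `l` and the
double sums can be interchanged; the truncated differences `l - k` do no harm. -/
theorem sum_choose_fin_eq {m l : ℕ} (h : l < m) (F : ℕ → ℝ) :
    ∑ k : Fin m, (l.choose k : ℝ) * F k =
      ∑ k ∈ Finset.range (l + 1), (l.choose k : ℝ) * F k := by
  rw [Fin.sum_univ_eq_sum_range (fun k => (l.choose k : ℝ) * F k) m]
  refine (Finset.sum_subset (Finset.range_subset_range.2 h) fun k _ hk => ?_).symm
  rw [Nat.choose_eq_zero_of_lt (by simpa using hk)]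
  simp

theorem diffOp_mulCoeff {m : ℕ} {D : Set ℝ} (hD : UniqueDiffOn ℝ D) (c : Fin (m + 1) → ℝ → ℝ)
    {g v : ℝ → ℝ} (hg : ContDiffOn ℝ m g D) (hv : ContDiffOn ℝ m v D) {t : ℝ} (ht : t ∈ D) :
    diffOp D (mulCoeff D c g) v t = diffOp D c (fun s => v s * g s) t := by
  simp only [diffOp, mulCoeff, Finset.sum_mul]
  rw [Finset.sum_comm]
  refine Finset.sum_congr rfl fun l _ => ?_
  have hl : ((l : ℕ) : WithTop ℕ∞) ≤ (m : WithTop ℕ∞) := by norm_cast; omega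
  rw [iteratedDerivWithin_mul_eq_sum hD (hv.of_le hl) (hg.of_le hl) ht,
    ← sum_choose_fin_eq l.2 (fun i => iteratedDerivWithin i v D t * iteratedDerivWithin (l - i) g D t),
    Finset.mul_sum]
  exact Finset.sum_congr rfl fun k _ => by ring

/-- The lower order part of the equation for `u`, where `u g` solves the equation with
coefficients `c`. -/
theorem sum_mulCoeff_div {n : ℕ} {D : Set ℝ} (hD : UniqueDiffOn ℝ D) {c : Fin (n + 2) → ℝ → ℝ}
    (hc : IsRegularOperator D c) {g u : ℝ → ℝ} (hg : ContDiffOn ℝ n g D) (hu : ContDiffOn ℝ n u D)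
    (hg0 : ∀ t ∈ D, g t ≠ 0) {t : ℝ} (ht : t ∈ D) (x : ℝ) :
    ∑ k : Fin (n + 1), mulCoeff D c g k.castSucc t / mulCoeff D c g (Fin.last (n + 1)) t *
        iteratedDerivWithin k u D t * (g t * x) =
      ∑ k : Fin (n + 1), c k.castSucc t / c (Fin.last (n + 1)) t *
          iteratedDerivWithin k (fun s => u s * g s) D t * x +
        (∑ i ∈ Finset.range (n + 1), ((n + 1).choose i : ℝ) *
          (iteratedDerivWithin i u D t * iteratedDerivWithin (n + 1 - i) g D t)) * x := by
  have h0 := hg0 t ht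
  have h1 := hc.leading_ne_zero t ht
  have h2 : ∀ l : Fin (n + 1), iteratedDerivWithin l (fun s => u s * g s) D t =
      ∑ k : Fin (n + 1), ((l : ℕ).choose k : ℝ) *
        (iteratedDerivWithin k u D t * iteratedDerivWithin (l - k) g D t) := fun l => by
    have hl : ((l : ℕ) : WithTop ℕ∞) ≤ (n : WithTop ℕ∞) := by norm_cast; omega
    rw [iteratedDerivWithin_mul_eq_sum hD (hu.of_le hl) (hg.of_le hl) ht]
    exact (sum_choose_fin_eq l.2
      (fun i => iteratedDerivWithin i u D t * iteratedDerivWithin (l - i) g D t)).symm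
  rw [← Fin.sum_univ_eq_sum_range (fun i => ((n + 1).choose i : ℝ) *
      (iteratedDerivWithin i u D t * iteratedDerivWithin (n + 1 - i) g D t)) (n + 1)]
  simp only [h2, mulCoeff_last, Finset.sum_mul, Finset.mul_sum]
  rw [Finset.sum_comm, ← Finset.sum_add_distrib]
  refine Finset.sum_congr rfl fun k _ => ?_
  -- The terms `l ≤ n` give the lower order part for `u g`; in the term `l = n + 1` the leading
  -- coefficient cancels, leaving the Leibniz remainder.
  rw [mulCoeff, Fin.sum_univ_castSucc, add_div, add_mul, add_mul, Finset.sum_div, Finset.sum_mul,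
    Finset.sum_mul]
  congr 1
  · refine Finset.sum_congr rfl fun l _ => ?_
    simp only [Fin.val_castSucc]
    field_simp
  · simp only [Fin.val_castSucc, Fin.val_last]
    field_simp

/-- If `u g` satisfies the left-hand side of the weak equation with test function `ψ`, then so does
`u` for the operator `v ↦ L[v g]` with test function `g ψ`. -/
theorem weak_lhs_mulCoeff {n : ℕ} {D : Set ℝ} (hD : UniqueDiffOn ℝ D) {c : Fin (n + 2) → ℝ → ℝ}
    (hc : IsRegularOperator D c) {g u ψ : ℝ → ℝ} (hg : ContDiffOn ℝ (n + 1 : ℕ) g D)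
    (hu : ContDiffOn ℝ n u D) (hg0 : ∀ t ∈ D, g t ≠ 0) (hψ : IsTestFunction D 1 ψ)
    (hDm : MeasurableSet D) :
    -(∫ t in D, iteratedDerivWithin n u D t * deriv (fun s => g s * ψ s) t) +
      ∑ k : Fin (n + 1), ∫ t in D,
        mulCoeff D c g k.castSucc t / mulCoeff D c g (Fin.last (n + 1)) t *
          iteratedDerivWithin k u D t * (g t * ψ t) =
    -(∫ t in D, iteratedDerivWithin n (fun s => u s * g s) D t * deriv ψ t) +
      ∑ k : Fin (n + 1), ∫ t in D, c k.castSucc t / c (Fin.last (n + 1)) t *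
        iteratedDerivWithin k (fun s => u s * g s) D t * ψ t := by
  have hgn : ContDiffOn ℝ n g D := hg.of_le (by exact_mod_cast Nat.le_succ n)
  have hψ0 := hψ.of_le (Nat.zero_le 1)
  have hφ : IsTestFunction D 1 (fun s => g s * ψ s) :=
    hψ.mul_left (hg.of_le (by exact_mod_cast Nat.le_add_left 1 n))
  have hc' := isRegularOperator_mulCoeff hD hc hg hg0
  have cont : ∀ {b : Fin (n + 2) → ℝ → ℝ} {v : ℝ → ℝ}, IsRegularOperator D b →
      ContDiffOn ℝ n v D → ∀ k : Fin (n + 1),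
      ContinuousOn (fun t => b k.castSucc t / b (Fin.last (n + 1)) t *
        iteratedDerivWithin k v D t) D := fun hb hv k =>
    ((hb.continuousOn _).div (hb.continuousOn _) hb.leading_ne_zero).mul
      (hv.continuousOn_iteratedDerivWithin (by norm_cast; omega) hD)
  have cB : ContinuousOn (fun t => ∑ i ∈ Finset.range (n + 1), ((n + 1).choose i : ℝ) *
      (iteratedDerivWithin i u D t * iteratedDerivWithin (n + 1 - i) g D t)) D :=
    continuousOn_finsetSum _ fun i hi => by
      have hi := Finset.mem_range.1 hi
      exact continuousOn_const.mul
        ((hu.continuousOn_iteratedDerivWithin (by norm_cast; omega) hD).mul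
          (hg.continuousOn_iteratedDerivWithin (by norm_cast; omega) hD))
  -- The remainder from moving the derivative equals the extra term of `sum_mulCoeff_div`, so the
  -- two cancel.
  rw [setIntegral_iteratedDerivWithin_mul_deriv hD hu hg hψ,
    ← integral_finsetSum _ fun k _ =>
      ((hφ.of_le (Nat.zero_le 1)).integrable_mul (cont hc' hu k)).integrableOn,
    ← integral_finsetSum _ fun k _ => (hψ0.integrable_mul (cont hc (hu.mul hgn) k)).integrableOn,
    setIntegral_congr_fun hDm fun t ht => sum_mulCoeff_div hD hc hgn hu hg0 ht (ψ t),
    integral_add (integrable_finsetSum _ fun k _ =>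
      (hψ0.integrable_mul (cont hc (hu.mul hgn) k)).integrableOn)
      (hψ0.integrable_mul cB).integrableOn]
  ring

/-! ### Solutions of the transformed equations -/

variable {Ω : Type*} [MeasurableSpace Ω]

theorem IsSDESolution.mul_left {m : ℕ} (hm : 1 ≤ m) {D : Set ℝ} (hD : UniqueDiffOn ℝ D)
    (hDm : MeasurableSet D) {c : Fin (m + 1) → ℝ → ℝ} (hc : IsRegularOperator D c)
    {μ : Measure Ω} {W : (ℝ → ℝ) → Ω → ℝ} {y : ℝ → Ω → ℝ} (hy : IsSDESolution D c μ W y)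
    {f : ℝ → ℝ} (hf : ∀ t ∈ D, f t ≠ 0) (hf' : ContDiffOn ℝ m f D) :
    IsSDESolution D (mulCoeff D c fun t => 1 / f t) μ W (fun t ω => f t * y t ω) where
  gaussian := hy.gaussian.smul (fun t : D => f t)
  mean_zero t ht := by rw [integral_const_mul, hy.mean_zero t ht, mul_zero]
  paths := by
    filter_upwards [hy.paths] with ω hω
    exact (hf'.of_le (by norm_cast; omega)).mul hω
  equation φ hφ := by
    obtain ⟨n, rfl⟩ : ∃ n, m = n + 1 := ⟨m - 1, by omega⟩
    have hψ : IsTestFunction D 1 (fun t => f t * φ t) :=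
      hφ.mul_left (hf'.of_le (by exact_mod_cast Nat.le_add_left 1 n))
    have hg : ContDiffOn ℝ (n + 1 : ℕ) (fun t => 1 / f t) D := contDiffOn_const.div hf' hf
    have hg0 : ∀ t ∈ D, 1 / f t ≠ 0 := fun t ht => one_div_ne_zero (hf t ht)
    have hφ' : (fun t => 1 / f t * (f t * φ t)) = φ := by
      funext t
      by_cases ht : t ∈ D
      · have := hf t ht
        field_simp
      · simp [hφ.eq_zero ht]
    filter_upwards [hy.paths, hy.equation _ hψ] with ω hpath heq
    have hu : ContDiffOn ℝ n (fun t => f t * y t ω) D :=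
      (hf'.of_le (by exact_mod_cast Nat.le_succ n)).mul hpath
    have hz : EqOn (fun s => f s * y s ω * (1 / f s)) (fun s => y s ω) D := fun s hs => by
      have := hf s hs
      simp only
      field_simp
    have h := weak_lhs_mulCoeff hD hc hg hu hg0 hψ hDm
    rw [hφ'] at h
    have h1 : ∀ t ∈ D, ∀ k, iteratedDerivWithin k (fun s => f s * y s ω * (1 / f s)) D t =
        iteratedDerivWithin k (fun s => y s ω) D t := fun t ht k =>
      iteratedDerivWithin_congr hz ht
    -- `W` takes functions on the whole line, so equality is needed off `D` too; where `f t = 0`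
    -- both sides are `0`, as division by zero gives `0`.
    have hW : (fun t => φ t / mulCoeff D c (fun t => 1 / f t) (Fin.last (n + 1)) t) =
        fun t => f t * φ t / c (Fin.last (n + 1)) t := by
      funext t
      rw [mulCoeff_last, mul_one_div, div_div_eq_mul_div, mul_comm]
    rw [hW, ← heq]
    have e1 : ∫ t in D, iteratedDerivWithin n (fun s => f s * y s ω * (1 / f s)) D t *
        deriv (fun t => f t * φ t) t = ∫ t in D, iteratedDerivWithin n (fun s => y s ω) D t *
        deriv (fun t => f t * φ t) t :=
      setIntegral_congr_fun hDm fun t ht => by simp only [h1 t ht]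
    have e2 : ∀ k : Fin (n + 1), ∫ t in D, c k.castSucc t / c (Fin.last (n + 1)) t *
        iteratedDerivWithin k (fun s => f s * y s ω * (1 / f s)) D t * (f t * φ t) =
        ∫ t in D, c k.castSucc t / c (Fin.last (n + 1)) t *
        iteratedDerivWithin k (fun s => y s ω) D t * (f t * φ t) := fun k =>
      setIntegral_congr_fun hDm fun t ht => by simp only [h1 t ht]
    rw [e1, Finset.sum_congr rfl fun k _ => e2 k] at h
    simp only [fun t : ℝ => congrFun hφ' t] at h
    exact h
  causal s hs := by
    -- The past of `f y` is a deterministic measurable function of the past of `y`.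
    have := (hy.causal s hs).comp (φ := fun (x : {r : ℝ // r ∈ D ∧ r ≤ s} → ℝ) (r : {r : ℝ // r ∈ D ∧ r ≤ s}) => f r * x r)
      (ψ := id) (by fun_prop) measurable_id
    exact this

theorem IsFundamentalSystem.mul_left {m : ℕ} {D : Set ℝ} (hD : UniqueDiffOn ℝ D)
    {c : Fin (m + 1) → ℝ → ℝ} {P : Fin m → ℝ → ℝ} (hP : IsFundamentalSystem D c P)
    {f : ℝ → ℝ} (hf : ∀ t ∈ D, f t ≠ 0) (hf' : ContDiffOn ℝ m f D) :
    IsFundamentalSystem D (mulCoeff D c fun t => 1 / f t) (fun i t => f t * P i t) where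
  contDiffOn i := hf'.mul (hP.contDiffOn i)
  diffOp_eq_zero i t ht := by
    have hg : ContDiffOn ℝ m (fun t => 1 / f t) D := contDiffOn_const.div hf' hf
    rw [diffOp_mulCoeff hD c hg (hf'.mul (hP.contDiffOn i)) ht,
      ← hP.diffOp_eq_zero i t ht]
    refine Finset.sum_congr rfl fun k _ => ?_
    congr 1
    refine iteratedDerivWithin_congr (fun s hs => ?_) ht
    have := hf s hs
    field_simp
  linearIndependent := by
    refine Fintype.linearIndependent_iff.2 fun a ha =>
      Fintype.linearIndependent_iff.1 hP.linearIndependent a (funext fun t => ?_)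
    have h := congrFun ha t
    simp only [Finset.sum_apply, Pi.smul_apply, smul_eq_mul, Pi.zero_apply,
      Set.domRestrict_apply] at h ⊢
    refine (mul_eq_zero.1 (?_ : f t * _ = 0)).resolve_left (hf t t.2)
    rw [← h, Finset.mul_sum]
    exact Finset.sum_congr rfl fun i _ => by ring

/-! ### Kernel packet systems -/

/-- Multiplication of the kernel by a function without zeros does not change the vanishing of the
first `m` derivatives of its linear combinations at a point. -/
theorem forall_sum_kernelDeriv_mul_eq_zero_iff {m : ℕ} {D : Set ℝ} (hD : UniqueDiffOn ℝ D)
    {K : ℝ → ℝ → ℝ} (hK : ∀ t ∈ D, ContDiffOn ℝ ((m - 1 : ℕ) : ℕ∞) (fun s => K t s) D)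
    {f : ℝ → ℝ} (hf : ∀ t ∈ D, f t ≠ 0) (hf' : ContDiffOn ℝ m f D) {ι : Type*} [Fintype ι]
    {τ : ι → ℝ} (hτ : ∀ j, τ j ∈ D) (a : ι → ℝ) {s : ℝ} (hs : s ∈ D) :
    (∀ i : Fin m, ∑ j, a j * kernelDeriv D (fun t t' => f t * f t' * K t t') i (τ j) s = 0) ↔
      ∀ i : Fin m, ∑ j, a j * f (τ j) * kernelDeriv D K i (τ j) s = 0 := by
  have hle : ∀ i < m, ((i : ℕ) : WithTop ℕ∞) ≤ (m : WithTop ℕ∞) := fun i hi => by norm_cast; omega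
  have hK' : ∀ i < m, ∀ j, ContDiffOn ℝ i (fun s => K (τ j) s) D := fun i hi j =>
    (hK _ (hτ j)).of_le (by norm_cast; omega)
  set G : ℝ → ℝ := fun r => ∑ j, a j * f (τ j) * K (τ j) r with hG
  have cG : ∀ i < m, ContDiffOn ℝ i G D := fun i hi =>
    ContDiffOn.sum fun j _ => contDiffOn_const.mul (hK' i hi j)
  have cf : ∀ i < m, ContDiffOn ℝ i f D := fun i hi => hf'.of_le (hle i hi)
  have cg : ∀ i < m, ContDiffOn ℝ i (fun t => 1 / f t) D := fun i hi =>
    contDiffOn_const.div (cf i hi) hf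
  have e1 : ∀ i < m, ∑ j, a j * f (τ j) * kernelDeriv D K i (τ j) s =
      iteratedDerivWithin i G D s := fun i hi =>
    (iteratedDerivWithin_sum_mul hD (hK' i hi) hs).symm
  have e2 : ∀ i < m, ∑ j, a j * kernelDeriv D (fun t t' => f t * f t' * K t t') i (τ j) s =
      iteratedDerivWithin i (fun r => G r * f r) D s := fun i hi => by
    refine (iteratedDerivWithin_sum_mul hD (fun j => (contDiffOn_const.mul (cf i hi)).mul
      (hK' i hi j)) hs).symm.trans ?_
    congr 1
    funext r
    rw [hG, Finset.sum_mul]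
    exact Finset.sum_congr rfl fun j _ => by ring
  constructor
  · intro h i
    rw [e1 i i.2]
    have h' : ∀ i < m, iteratedDerivWithin i (fun r => G r * f r) D s = 0 := fun i hi =>
      (e2 i hi).symm.trans (h ⟨i, hi⟩)
    -- Here `G` is recovered on `D` as `(G f) (1/f)`.
    rw [← iteratedDerivWithin_mul_eq_zero hD i.2 ((cG i i.2).mul (cf i i.2)) (cg i i.2) hs h']
    refine iteratedDerivWithin_congr (fun r hr => ?_) hs
    have := hf r hr
    field_simp
  · intro h i
    rw [e2 i i.2]
    exact iteratedDerivWithin_mul_eq_zero hD i.2 (cG i i.2) (cf i i.2) hs fun k hk =>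
      (e1 k hk).symm.trans (h ⟨k, hk⟩)

theorem kpMatrix_mulVec_eq_zero_iff {m : ℕ} {D : Set ℝ} {K : ℝ → ℝ → ℝ} {P : Fin m → ℝ → ℝ}
    {τ a : Fin (2 * m + 1) → ℝ} :
    (kpMatrix D K P τ).mulVec a = 0 ↔ (∀ i, ∑ j, a j * P i (τ j) = 0) ∧
      ∀ i : Fin m, ∑ j, a j * kernelDeriv D K i (τ j) (τ (Fin.last (2 * m))) = 0 := by
  simp only [funext_iff, Sum.forall, kpMatrix, Matrix.mulVec, dotProduct, Matrix.fromRows_apply_inl,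
    Matrix.fromRows_apply_inr, Matrix.of_apply, Pi.zero_apply, mul_comm (a _)]

theorem HasKPSystem.mul_left {m : ℕ} {D : Set ℝ} (hD : UniqueDiffOn ℝ D)
    {c : Fin (m + 1) → ℝ → ℝ} {K : ℝ → ℝ → ℝ} (hKP : HasKPSystem D c K)
    {f : ℝ → ℝ} (hf : ∀ t ∈ D, f t ≠ 0) (hf' : ContDiffOn ℝ m f D) :
    HasKPSystem D (mulCoeff D c fun t => 1 / f t) (fun t t' => f t * f t' * K t t') := by
  obtain ⟨hK, P, hP, hsys⟩ := hKP
  refine ⟨fun t ht => (contDiffOn_const.mul (hf'.of_le (by norm_cast; omega))).mul (hK t ht),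
    fun i t => f t * P i t, hP.mul_left hD hf hf', fun τ hτ hτD => ?_⟩
  obtain ⟨h1, h2, h3⟩ := hsys τ hτ hτD
  have hτ' : ∀ j, τ j ∈ D := fun j => interior_subset (hτD j)
  have hfτ : ∀ j, f (τ j) ≠ 0 := fun j => hf _ (hτ' j)
  have hmat : ∀ a : Fin (2 * m + 1) → ℝ,
      (kpMatrix D (fun t t' => f t * f t' * K t t') (fun i t => f t * P i t) τ).mulVec a = 0 ↔
      (kpMatrix D K P τ).mulVec (fun j => a j * f (τ j)) = 0 := fun a => by
    rw [kpMatrix_mulVec_eq_zero_iff, kpMatrix_mulVec_eq_zero_iff,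
      forall_sum_kernelDeriv_mul_eq_zero_iff hD hK hf hf' hτ' a (hτ' _)]
    simp only [mul_assoc]
  refine ⟨fun a => ?_, ?_, fun a ha h => ?_⟩
  · rw [hmat, h1, KPEquations, KPEquations,
      forall_sum_kernelDeriv_mul_eq_zero_iff hD hK hf hf' hτ' a (hτ' _),
      forall_sum_kernelDeriv_mul_eq_zero_iff hD hK hf hf' hτ' a (hτ' _)]
  -- The substitution `a ↦ b` is a linear automorphism because no `f (τ j)` is zero, so it preserves
  -- the dimension of the solution space.
  · let e : (Fin (2 * m + 1) → ℝ) ≃ₗ[ℝ] (Fin (2 * m + 1) → ℝ) :=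
      LinearEquiv.piCongrRight fun j => LinearEquiv.smulOfNeZero ℝ ℝ (f (τ j)) (hfτ j)
    have he : ∀ a, e a = fun j => a j * f (τ j) := fun a => funext fun j => mul_comm _ _
    have hker : LinearMap.ker (kpMatrix D (fun t t' => f t * f t' * K t t')
        (fun i t => f t * P i t) τ).mulVecLin =
        (LinearMap.ker (kpMatrix D K P τ).mulVecLin).comap (e : _ →ₗ[ℝ] _) := by
      ext a
      simp only [LinearMap.mem_ker, Matrix.mulVecLin_apply, Submodule.mem_comap,
        LinearEquiv.coe_coe, he, hmat]
    exact ((LinearEquiv.ofEq _ _ hker).trans (e.ofSubmodule' _)).finrank_eq.trans h2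
  · obtain ⟨hsupp, t, htD, hne⟩ := h3 (fun j => a j * f (τ j))
      (fun h0 => ha (funext fun j => (mul_eq_zero.1 (congrFun h0 j)).resolve_right (hfτ j)))
      ((hmat a).1 h)
    have hsum : ∀ t, ∑ j, a j * (f t * f (τ j) * K t (τ j)) =
        f t * ∑ j, a j * f (τ j) * K t (τ j) := fun t => by
      rw [Finset.mul_sum]
      exact Finset.sum_congr rfl fun j _ => by ring
    refine ⟨fun s hs hs' => ?_, t, htD, ?_⟩
    · rw [hsum, hsupp s hs hs', mul_zero]
    · rw [hsum]
      exact mul_ne_zero (hf t htD) hne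

end KernelPacket

theorem mainTheorem11 {Ω : Type*} [MeasurableSpace Ω] (μ : Measure Ω) [IsProbabilityMeasure μ]
    (m : ℕ) (hm : 1 ≤ m)
    (D : Set ℝ) (hD : D.OrdConnected) (hD' : (interior D).Nonempty)
    (c : Fin (m + 1) → ℝ → ℝ) (hc : KernelPacket.IsRegularOperator D c)
    (W : (ℝ → ℝ) → Ω → ℝ) (hW : KernelPacket.IsWhiteNoise D μ W)
    (y : ℝ → Ω → ℝ) (hy : KernelPacket.IsSDESolution D c μ W y)
    (hcond : KernelPacket.BoundedFundamentalSolutions D c)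
    (K : ℝ → ℝ → ℝ) (hK : ∀ t ∈ D, ∀ t' ∈ D, K t t' = ∫ ω, y t ω * y t' ω ∂μ)
    (hKP : KernelPacket.HasKPSystem D c K)
    (f : ℝ → ℝ) (hf : ∀ t ∈ D, f t ≠ 0) (hf' : ContDiffOn ℝ m (fun t => 1 / f t) D) :
    ∃ c' : Fin (m + 1) → ℝ → ℝ,
      KernelPacket.IsRegularOperator D c' ∧
      (∀ v : ℝ → ℝ, ContDiffOn ℝ m v D → ∀ t ∈ D,
        KernelPacket.diffOp D c' v t = KernelPacket.diffOp D c (fun s => v s / f s) t) ∧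
      KernelPacket.IsSDESolution D c' μ W (fun t ω => f t * y t ω) ∧
      (∀ t ∈ D, ∀ t' ∈ D,
        f t * f t' * K t t' = ∫ ω, (f t * y t ω) * (f t' * y t' ω) ∂μ) ∧
      KernelPacket.HasKPSystem D c' (fun t t' => f t * f t' * K t t') := by
  have hDu : UniqueDiffOn ℝ D := uniqueDiffOn_convex hD.convex hD'
  have hg0 : ∀ t ∈ D, 1 / f t ≠ 0 := fun t ht => one_div_ne_zero (hf t ht)
  have hfD : ContDiffOn ℝ m f D := 
    (hf'.inv hg0).congr fun t _ => by simp
  refine ⟨KernelPacket.mulCoeff D c fun t => 1 / f t,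
    KernelPacket.isRegularOperator_mulCoeff hDu hc hf' hg0, fun v hv t ht => ?_,
    hy.mul_left hm hDu hD.measurableSet hc hf hfD, fun t ht t' ht' => ?_,
    hKP.mul_left hDu hf hfD⟩
  · rw [KernelPacket.diffOp_mulCoeff hDu c hf' hv ht]
    simp only [mul_one_div]
  · rw [hK t ht t' ht', ← integral_const_mul]
    congr 1
    funext ω
    ring
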